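/- **Setting.** Let $d$ be a prime, $F=\mathbb{Z}/d\mathbb{Z}$, and let $\mathsf H$ be a Hilbert space with orthonormal basis $\{|j\rangle\}_{j\in F}$. Let $\omega$ be a primitive $d$-th root of unity, $X|j\rangle=|j-1\rangle$, $Z|j\rangle=\omega^j|j\rangle$, $N_{(i,j)}=X^iZ^j$, and $N_x=N_{x_1}\otimes\dots\otimes N_{x_n}$ for $x\in(F^2)^n\cong F^{2n}$. Equip $F^{2n}$ with the symplectic form $\langle x,y\rangle=\sum_{i=1}^n(u_iv_i'-v_iu_i')$, where $x_i=(u_i,v_i)$ and $y_i=(u'_i,v'_i)$. Let $P$ be a probability distribution on $F^2$, let $P^n$ be its $n$-fold product, and let $\mathcal A(\rho)=\sum_{u\in F^2}P(u)N_u\rho N_u^\dagger$ be the corresponding Pauli channel. All logarithms are to base $d$, and $0\log 0=0$. $H$ denotes the Shannon entropy and $S$ the von Neumann entropy. **Code.** Let $0\le k\le n$ and let $L\subset F^{2n}$ be a subspace with $L\subset L^\perp$ and $\dim L=n-k$. Let $g_1,\dots,g_n,h_1,\dots,h_n\in F^{2n}$ satisfy $L=\mathrm{span}\{g_1,\dots,g_{n-k}\}$,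 $\langle g_i,h_j\rangle=\delta_{ij}$ and $\langle g_i,g_j\rangle=\langle h_i,h_j\rangle=0$ for all $i,j$. Let $\mathcal C\subset\mathsf H^{\otimes n}$ be a symplectic code with stabilizer $N_L=\{N_x\mid x\in L\}$, that is, a $d^k$-dimensional subspace of the form $\{\psi\mid M\psi=\tau(M)\psi\ \ \forall M\in N_L\}$ with scalars $\tau(M)$. **Probability array.** For $s\in F^{n-k}$ and $u=((u_1,u_1'),\dots,(u_k,u_k'))\in (F^{2})^k$ let $P_L(s,u)$ be the sum of $P^n(x)$ over all $x=\sum_{i=1}^n(w_ig_i+z_ih_i)$ (with $w_i,z_i\in F$) such that $z_i=s_i$ for $i\le n-k$ and $(w_i,z_i)=(u_{i-n+k},u'_{i-n+k})$ for $i>n-k$. Let $\overline{P_L}(s)=\sum_uP_L(s,u)$ be the row marginal, let $\overleftarrow{P_L}(u|s)=P_L(s,u)/\overline{P_L}(s)$ where $\overline{P_L}(s)>0$, and let $$H(\overleftarrow{P_L}|\overline{P_L})=-\sum_{s:\,\overline{P_L}(s)>0}\ \sum_u\overline{P_L}(s)\,\overleftarrow{P_L}(u|s)\log_d\overleftarrow{P_L}(u|s).$$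 **Claim.** Let $\rho=(\dim\mathcal C)^{-1}\Pi_{\mathcal C}$, where $\Pi_{\mathcal C}$ is the orthogonal projection onto $\mathcal C$. Let $I_{\rm c}(\rho,\mathcal A^{\otimes n})=S(\mathcal A^{\otimes n}(\rho))-S([\mathrm I\otimes\mathcal A^{\otimes n}](|\Psi\rangle\langle\Psi|))$ be the coherent information, with $|\Psi\rangle$ a purification of $\rho$. Then $$k-H(\overleftarrow{P_L}|\overline{P_L})=I_{\rm c}(\rho,\mathcal A^{\otimes n}).$$ Moreover $$S(\mathcal A^{\otimes n}(\rho))=H(\overline{P_L})+k,$$ and, for every purification $|\Psi\rangle$ of $\rho$ by a finite-dimensional reference system, $$S\big([\mathrm I\otimes\mathcal A^{\otimes n}](|\Psi\rangle\langle\Psi|)\big)=H(\overline{P_L})+H(\overleftarrow{P_L}|\overline{P_L}).$$ -/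

import Mathlib

open scoped Matrix

noncomputable section

namespace SympCode

/-! ### Classical distributions and entropies (logarithms to base `d`) -/

/-- `P` is a probability distribution on the finite set `Y`. -/
def IsProbDist {Y : Type*} [Fintype Y] (P : Y → ℝ) : Prop :=
  (∀ y, 0 ≤ P y) ∧ ∑ y, P y = 1

/-- Shannon entropy to base `d`: `H(Q) = - ∑ u, Q(u) log_d Q(u)`. -/
def shannonEntropy (d : ℕ) {Y : Type*} [Fintype Y] (Q : Y → ℝ) : ℝ :=
  -∑ u, Q u * Real.logb d (Q u)

/-- The marginal on the first component. -/
def marginal {Y Z : Type*} [Fintype Z] (Q : Y × Z → ℝ) (u : Y) : ℝ :=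
  ∑ v, Q (u, v)

/-- The conditional distribution `Q(u, v) / ∑ v', Q(u, v')` of the second component given
the first; it is only used at those `u` whose marginal probability is positive. -/
def conditional {Y Z : Type*} [Fintype Z] (Q : Y × Z → ℝ) (u : Y) (v : Z) : ℝ :=
  Q (u, v) / marginal Q u

open Classical in
/-- The entropy `H(W | p)` of the stochastic matrix `W(v | u)` conditional on `p`, to base `d`. -/
def condEntropy (d : ℕ) {Y Z : Type*} [Fintype Y] [Fintype Z]
    (W : Y → Z → ℝ) (p : Y → ℝ) : ℝ :=
  -∑ u ∈ Finset.univ.filter (fun u => 0 < p u), ∑ v, p u * W u v * Real.logb d (W u v)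

/-- The product distribution `P^n`. -/
def prodDist {Y : Type*} {n : ℕ} (P : Y → ℝ) (x : Fin n → Y) : ℝ :=
  ∏ t, P (x t)

/-! ### Linear maps on operators, purifications, coherent information

Operators on a Hilbert space with a fixed orthonormal basis indexed by `ι` are matrices. -/

/-- The linear map `ρ ↦ ∑ i, K i * ρ * (K i)ᴴ` with operator-sum representation `K`. -/
def krausMap {ι κ : Type*} [Fintype ι] [Fintype κ] (K : κ → Matrix ι ι ℂ) :
    Matrix ι ι ℂ →ₗ[ℂ] Matrix ι ι ℂ where
  toFun ρ := ∑ i, K i * ρ * (K i)ᴴ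
  map_add' ρ σ := by simp [Matrix.mul_add, Matrix.add_mul, Finset.sum_add_distrib]
  map_smul' c ρ := by simp [Finset.smul_sum]

/-- The tensor power `M^{⊗n}` of a linear map on operators: the linear map that sends a tensor
product of matrix units `⊗ₜ E_{i(t), j(t)}` to `⊗ₜ M (E_{i(t), j(t)})`. -/
def tensorPower {ι : Type*} [Fintype ι] [DecidableEq ι] (n : ℕ)
    (M : Matrix ι ι ℂ →ₗ[ℂ] Matrix ι ι ℂ) :
    Matrix (Fin n → ι) (Fin n → ι) ℂ →ₗ[ℂ] Matrix (Fin n → ι) (Fin n → ι) ℂ where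
  toFun ρ := Matrix.of fun a b =>
    ∑ i, ∑ j, ρ i j * ∏ t, M (Matrix.single (i t) (j t) 1) (a t) (b t)
  map_add' ρ σ := by
    ext a b
    simp [add_mul, Finset.sum_add_distrib]
  map_smul' c ρ := by
    ext a b
    simp [Finset.mul_sum, mul_assoc]

/-- The map `I ⊗ M`, where `I` is the identity map on the operators of a reference system with
basis indexed by `R`: it applies `M` to each `ι × ι` block. -/
def idTensor (R : Type*) {ι : Type*} (M : Matrix ι ι ℂ →ₗ[ℂ] Matrix ι ι ℂ) :
    Matrix (R × ι) (R × ι) ℂ →ₗ[ℂ] Matrix (R × ι) (R × ι) ℂ where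
  toFun σ := Matrix.of fun a b => M (Matrix.of fun i j => σ (a.1, i) (b.1, j)) a.2 b.2
  map_add' σ τ := by
    ext a b
    exact congrFun (congrFun (M.map_add (Matrix.of fun i j => σ (a.1, i) (b.1, j))
      (Matrix.of fun i j => τ (a.1, i) (b.1, j))) a.2) b.2
  map_smul' c σ := by
    ext a b
    exact congrFun (congrFun (M.map_smul c (Matrix.of fun i j => σ (a.1, i) (b.1, j))) a.2) b.2

open Classical in
/-- Von Neumann entropy to base `d` of a density operator: `- ∑ λ log_d λ` over its eigenvalues,
counted with multiplicity (value `0` by convention for matrices that are not Hermitian). -/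
def vonNeumannEntropy (d : ℕ) {ι : Type*} [Fintype ι] (σ : Matrix ι ι ℂ) : ℝ :=
  if h : σ.IsHermitian then -∑ i, h.eigenvalues i * Real.logb d (h.eigenvalues i) else 0

/-- The operator `|Ψ⟩⟨Ψ|`. -/
def ketBra {ι : Type*} (Ψ : ι → ℂ) : Matrix ι ι ℂ :=
  Matrix.vecMulVec Ψ (star Ψ)

/-- The vector `Ψ` of the bipartite system purifies `ρ`: tracing out the reference system `R`
from `|Ψ⟩⟨Ψ|` gives `ρ`. -/
def IsPurification {R ι : Type*} [Fintype R] (Ψ : R × ι → ℂ) (ρ : Matrix ι ι ℂ) : Prop :=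
  ∀ i j, ∑ r, ketBra Ψ (r, i) (r, j) = ρ i j

open Classical in
/-- The canonical purification `∑ r, |r⟩ ⊗ √ρ |r⟩` of `ρ`. -/
def canonicalPurification {ι : Type*} [Fintype ι] (ρ : Matrix ι ι ℂ) : ι × ι → ℂ :=
  fun a => cfc Real.sqrt ρ a.2 a.1

open scoped ComplexOrder in
theorem isPurification_canonicalPurification {ι : Type*} [Fintype ι] {ρ : Matrix ι ι ℂ}
    (hρ : ρ.PosSemidef) : IsPurification (canonicalPurification ρ) ρ := by
  classical
  have key : cfc Real.sqrt ρ * star (cfc Real.sqrt ρ) = ρ := by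
    have hs : IsSelfAdjoint ρ := hρ.1
    rw [← cfc_star, ← cfc_mul Real.sqrt _ ρ (by fun_prop) (by fun_prop)]
    conv_rhs => rw [← cfc_id ℝ ρ]
    apply cfc_congr
    intro x hx
    have hx0 : 0 ≤ x := by
      rw [hρ.1.spectrum_real_eq_range_eigenvalues] at hx
      obtain ⟨i, rfl⟩ := hx
      exact hρ.eigenvalues_nonneg i
    simp [Real.mul_self_sqrt hx0]
  intro i j
  have h := congrFun (congrFun key i) j
  simpa [Matrix.mul_apply, canonicalPurification, ketBra, Matrix.vecMulVec_apply] using h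

/-- The coherent information
`I_c(ρ, M) = S(M(ρ)) - S([I ⊗ M](|Ψ⟩⟨Ψ|))`, with `Ψ` a purification of `ρ`. -/
def coherentInformation (d : ℕ) {ι : Type*} [Fintype ι] (ρ : Matrix ι ι ℂ)
    (M : Matrix ι ι ℂ →ₗ[ℂ] Matrix ι ι ℂ) : ℝ :=
  vonNeumannEntropy d (M ρ)
    - vonNeumannEntropy d (idTensor ι M (ketBra (canonicalPurification ρ)))

/-- The matrix of the orthogonal projection onto a subspace `C`. -/
def projMatrix {ι : Type*} [Fintype ι] [DecidableEq ι]
    (C : Submodule ℂ (EuclideanSpace ℂ ι)) : Matrix ι ι ℂ :=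
  Matrix.toEuclideanLin.symm (C.starProjection : EuclideanSpace ℂ ι →ₗ[ℂ] EuclideanSpace ℂ ι)

/-- The maximally mixed state `(dim C)⁻¹ Π_C` on a subspace `C`. -/
def maxMixed {ι : Type*} [Fintype ι] [DecidableEq ι]
    (C : Submodule ℂ (EuclideanSpace ℂ ι)) : Matrix ι ι ℂ :=
  (Module.finrank ℂ C : ℂ)⁻¹ • projMatrix C

/-! ### Weyl operators and Pauli channels -/

section Weyl

variable {d : ℕ} [NeZero d]

/-- `X |j⟩ = |j - 1⟩`. -/
def weylX (d : ℕ) : Matrix (ZMod d) (ZMod d) ℂ :=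
  Matrix.of fun i j => if i = j - 1 then 1 else 0

/-- `Z |j⟩ = ω ^ j |j⟩`. -/
def weylZ (d : ℕ) (ω : ℂ) : Matrix (ZMod d) (ZMod d) ℂ :=
  Matrix.diagonal fun j => ω ^ j.val

/-- `N_{(i, j)} = X ^ i Z ^ j`. -/
def weyl (ω : ℂ) (u : ZMod d × ZMod d) : Matrix (ZMod d) (ZMod d) ℂ :=
  weylX d ^ u.1.val * weylZ d ω ^ u.2.val

/-- `N_x = N_{x_1} ⊗ ⋯ ⊗ N_{x_n}`. -/
def weylN (ω : ℂ) {n : ℕ} (x : Fin n → ZMod d × ZMod d) :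
    Matrix (Fin n → ZMod d) (Fin n → ZMod d) ℂ :=
  Matrix.of fun a b => ∏ t, weyl ω (x t) (a t) (b t)

/-- The Pauli channel with operator-sum representation `{√P(u) N_u}`. -/
def pauliChannel (ω : ℂ) (P : ZMod d × ZMod d → ℝ) :
    Matrix (ZMod d) (ZMod d) ℂ →ₗ[ℂ] Matrix (ZMod d) (ZMod d) ℂ :=
  krausMap fun u => ((Real.sqrt (P u) : ℝ) : ℂ) • weyl ω u

/-! ### Symplectic geometry and symplectic codes -/

/-- The standard symplectic form `∑ i, (u_i v'_i - v_i u'_i)`. -/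
def symp {n : ℕ} (x y : Fin n → ZMod d × ZMod d) : ZMod d :=
  ∑ i, ((x i).1 * (y i).2 - (x i).2 * (y i).1)

/-- `L^⊥`, as a set. -/
def perp {n : ℕ} (L : Submodule (ZMod d) (Fin n → ZMod d × ZMod d)) :
    Set (Fin n → ZMod d × ZMod d) :=
  {y | ∀ x ∈ L, symp x y = 0}

/-- `L ⊆ L^⊥`. -/
def IsSelfOrthogonal {n : ℕ} (L : Submodule (ZMod d) (Fin n → ZMod d × ZMod d)) : Prop :=
  (L : Set (Fin n → ZMod d × ZMod d)) ⊆ perp L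

/-- The set of operators `N_L = {N_x | x ∈ L}`. -/
def stabilizerSet (ω : ℂ) {n : ℕ} (L : Submodule (ZMod d) (Fin n → ZMod d × ZMod d)) :
    Set (Matrix (Fin n → ZMod d) (Fin n → ZMod d) ℂ) :=
  {M | ∃ x ∈ L, M = weylN ω x}

/-- `C` is a symplectic code with stabilizer `N_L`, where `dim L = n - k`: a `d ^ k`-dimensional
subspace of the form `{ψ | ∀ M ∈ N_L, M ψ = τ(M) ψ}`. -/
def IsSymplecticCode (ω : ℂ) {n : ℕ} (k : ℕ) (L : Submodule (ZMod d) (Fin n → ZMod d × ZMod d))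
    (C : Submodule ℂ (EuclideanSpace ℂ (Fin n → ZMod d))) : Prop :=
  Module.finrank ℂ C = d ^ k ∧
    ∃ τ : Matrix (Fin n → ZMod d) (Fin n → ZMod d) ℂ → ℂ,
      ∀ ψ, ψ ∈ C ↔ ∀ M ∈ stabilizerSet ω L, Matrix.toEuclideanLin M ψ = τ M • ψ

/-- The vectors `g_1, …, g_n, h_1, …, h_n` form mutually orthogonal hyperbolic pairs
`(g_i, h_i)`. -/
def IsHyperbolic {n : ℕ} (g h : Fin n → (Fin n → ZMod d × ZMod d)) : Prop :=
  ∀ i j, symp (g i) (h j) = (if i = j then 1 else 0) ∧ symp (g i) (g j) = 0 ∧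
    symp (h i) (h j) = 0

/-- The `i`-th of the first `n - k` indices. -/
def lowIdx {n : ℕ} (k : ℕ) (i : Fin (n - k)) : Fin n :=
  ⟨i, by omega⟩

/-- The `i`-th of the last `k` indices. -/
def highIdx {n k : ℕ} (hk : k ≤ n) (i : Fin k) : Fin n :=
  ⟨n - k + i, by omega⟩

open Classical in
/-- The distribution `P_L` on `F^{n-k} × F^{2k}`: the probability of `(s, u)` is the sum of
`P^n(x)` over the vectors `x = ∑ i, (w_i g_i + z_i h_i)` with `z_i = s_i` for the first `n - k`
indices and `(w_i, z_i) = u_{i-n+k}` for the last `k` indices. -/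
def cosetDist {n k : ℕ} (hk : k ≤ n) (g h : Fin n → (Fin n → ZMod d × ZMod d))
    (P : ZMod d × ZMod d → ℝ) :
    (Fin (n - k) → ZMod d) × (Fin k → ZMod d × ZMod d) → ℝ :=
  fun su => ∑ x ∈ Finset.univ.filter (fun x : Fin n → ZMod d × ZMod d =>
      ∃ w z : Fin n → ZMod d, x = ∑ i, (w i • g i + z i • h i) ∧
        (∀ i, z (lowIdx k i) = su.1 i) ∧
        (∀ i, w (highIdx hk i) = (su.2 i).1 ∧ z (highIdx hk i) = (su.2 i).2)),
    prodDist P x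

end Weyl

end SympCode

end

open SympCode

namespace SympCode

/-! ### Entropies -/

/-! The channel `A^{⊗n}` is the mixture of the conjugations by the unitaries `N_x` with weights
`P^n(x)`. In hyperbolic coordinates, `s` fixes `x` modulo `L^⊥` and `(s, u)` fixes `x` modulo `L`;
both entropies follow by reading off spectra.

For `z ∈ L^⊥`, `N_z` commutes with the code projection `Π`, so `N_x Π N_x†` depends on `s` alone.
For different `s` some `N_m`, `m ∈ L`, takes different eigenvalues on the translated codes, which
are therefore orthogonal. The output thus has each eigenvalue `P̄_L(s)/d^k` repeated `d^k` times,
and entropy `H(P̄_L) + k` (`vonNeumannEntropy_output`).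

For a purification `Ψ`, `N_L` acts on the code by phases, so the state of `(I ⊗ N_x)Ψ` depends only
on `(s, u)`. Vectors from distinct classes have inner product `tr(N_x† N_y ρ)`, which vanishes
because some `N_z`, `z ∈ L^⊥`, commutes with `ρ` but not with `N_{y-x}`. The entropy is thus
`H(P_L)` (`vonNeumannEntropy_purified_output`). The chain rule splits it, and `H(P̄_L)` cancels in
the difference. -/

theorem mul_sum_logb_div {d k : ℕ} (hd : 1 < d) {Y : Type*} [Fintype Y] {Q : Y → ℝ}
    (hQ : ∑ y, Q y = 1) :
    -∑ a : Y × Fin (d ^ k), Q a.1 / (d : ℝ) ^ k * Real.logb d (Q a.1 / (d : ℝ) ^ k)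
      = shannonEntropy d Q + k := by
  have hd0 : (0 : ℝ) < d := by positivity
  have hd1 : (d : ℝ) ≠ 1 := by exact_mod_cast hd.ne'
  have hdk : (d : ℝ) ^ k ≠ 0 := by positivity
  have key : ∀ y, ∑ _j : Fin (d ^ k), Q y / (d : ℝ) ^ k * Real.logb d (Q y / (d : ℝ) ^ k)
      = Q y * Real.logb d (Q y) - k * Q y := by
    intro y
    rw [Finset.sum_const, Finset.card_univ, Fintype.card_fin, nsmul_eq_mul]
    push_cast
    rw [← mul_assoc, mul_div_cancel₀ _ hdk]
    rcases eq_or_ne (Q y) 0 with h | h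
    · simp [h]
    · rw [Real.logb_div h hdk, Real.logb_pow, Real.logb_self_eq_one_iff.2 ⟨hd0.ne', hd1, by linarith⟩]
      ring
  rw [Fintype.sum_prod_type]
  simp only [key]
  rw [Finset.sum_sub_distrib, ← Finset.mul_sum, hQ, shannonEntropy]
  ring

theorem shannonEntropy_eq_marginal_add_condEntropy (d : ℕ) {Y Z : Type*} [Fintype Y] [Fintype Z]
    {Q : Y × Z → ℝ} (hQ : ∀ a, 0 ≤ Q a) :
    shannonEntropy d Q
      = shannonEntropy d (marginal Q) + condEntropy d (conditional Q) (marginal Q) := by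
  classical
  have hm : ∀ u, 0 ≤ marginal Q u := fun u => Finset.sum_nonneg fun v _ => hQ _
  unfold shannonEntropy condEntropy
  rw [← neg_add, Fintype.sum_prod_type, Finset.sum_filter, ← Finset.sum_add_distrib]
  congr 1
  refine Finset.sum_congr rfl fun u _ => ?_
  split_ifs with h
  · have : marginal Q u * Real.logb d (marginal Q u)
        = ∑ v, Q (u, v) * Real.logb d (marginal Q u) := by
      rw [← Finset.sum_mul, marginal]
    rw [this, ← Finset.sum_add_distrib]
    refine Finset.sum_congr rfl fun v _ => ?_
    rw [conditional, mul_div_cancel₀ _ h.ne']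
    rcases eq_or_ne (Q (u, v)) 0 with h0 | h0
    · simp [h0]
    · rw [Real.logb_div h0 h.ne']
      ring
  -- Rows of zero mass are left out of `condEntropy`; by nonnegativity all their entries vanish, so
  -- they add nothing to the joint entropy either.
  · have h0 : marginal Q u = 0 := le_antisymm (not_lt.1 h) (hm u)
    have h1 : ∀ v, Q (u, v) = 0 := fun v =>
      (Finset.sum_eq_zero_iff_of_nonneg fun v _ => hQ (u, v)).1 h0 v (Finset.mem_univ v)
    simp [h0, h1]

open Classical in
/-- The entropy of a mixture of orthonormal pure states is the Shannon entropy of the weights. -/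
theorem vonNeumannEntropy_of_orthonormal (d : ℕ) {ι A : Type*} [Fintype ι] [Fintype A]
    {σ : Matrix ι ι ℂ} (p : A → ℝ) (v : A → ι → ℂ)
    (hv : ∀ a b, star (v a) ⬝ᵥ v b = if a = b then 1 else 0)
    (hσ : σ = ∑ a, (p a : ℂ) • ketBra (v a)) :
    vonNeumannEntropy d σ = -∑ a, p a * Real.logb d (p a) := by
  have hH : σ.IsHermitian := by
    rw [Matrix.IsHermitian, hσ, Matrix.conjTranspose_sum]
    refine Finset.sum_congr rfl fun a _ => ?_
    ext i j
    simp [ketBra, Matrix.vecMulVec_apply, mul_comm]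
  set V : Matrix ι A ℂ := Matrix.of fun i a => v a i with hV
  have hVV : Vᴴ * V = 1 := by
    ext a b
    simpa [Matrix.mul_apply, dotProduct, Matrix.one_apply, V] using hv a b
  have hσV : σ = (V * Matrix.diagonal fun a => (p a : ℂ)) * Vᴴ := by
    ext i j
    rw [hσ, Matrix.sum_apply, Matrix.mul_apply]
    refine Finset.sum_congr rfl fun a _ => ?_
    simp [ketBra, Matrix.vecMulVec_apply, V, Matrix.mul_diagonal]
    ring
  -- The family `v` need not be a basis. Since `σ = (V D) Vᴴ` and `Vᴴ (V D) = D`, the characteristic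
  -- polynomials of `σ` and `D` agree up to powers of `X`.
  have hchar := Matrix.charpoly_mul_comm' (V * Matrix.diagonal fun a => (p a : ℂ)) Vᴴ
  rw [← hσV, ← Matrix.mul_assoc, hVV, Matrix.one_mul, Matrix.charpoly_diagonal] at hchar
  have hroots := congrArg Polynomial.roots hchar
  have hprod : (∏ a, (Polynomial.X - Polynomial.C (p a : ℂ))) ≠ 0 :=
    Finset.prod_ne_zero_iff.2 fun a _ => Polynomial.X_sub_C_ne_zero _
  rw [Polynomial.roots_mul (mul_ne_zero (pow_ne_zero _ Polynomial.X_ne_zero)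
      (Matrix.charpoly_monic σ).ne_zero),
    Polynomial.roots_mul (mul_ne_zero (pow_ne_zero _ Polynomial.X_ne_zero) hprod),
    Polynomial.roots_pow, Polynomial.roots_pow, Polynomial.roots_X,
    hH.roots_charpoly_eq_eigenvalues, Polynomial.roots_prod _ _ hprod] at hroots
  -- The function `z.re * logb d z.re` vanishes at `0`, so summing it over the roots discards the
  -- surplus zeros.
  have hsum := congrArg (fun s : Multiset ℂ => (s.map fun z => z.re * Real.logb d z.re).sum) hroots
  simp only [Multiset.map_add, Multiset.sum_add, Multiset.map_nsmul, Multiset.sum_nsmul,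
    Multiset.map_singleton, Multiset.sum_singleton, Complex.zero_re, zero_mul, smul_zero, zero_add,
    Multiset.map_map, Polynomial.roots_X_sub_C, Multiset.bind_singleton] at hsum
  rw [vonNeumannEntropy, dif_pos hH]
  congr 1

/-! ### Weyl operators -/

section Weyl

variable {d : ℕ} [NeZero d] {ω : ℂ}

theorem weylX_pow_apply (m : ℕ) (a b : ZMod d) :
    (weylX d ^ m) a b = if a = b - m then 1 else 0 := by
  induction m generalizing a b with
  | zero => simp [Matrix.one_apply]
  | succ m ih =>
    rw [pow_succ, Matrix.mul_apply]
    have hX : ∀ c, weylX d c b = if c = b - 1 then 1 else 0 := fun c => rfl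
    simp only [ih, hX, mul_ite, mul_one, mul_zero]
    rw [Finset.sum_ite_eq' Finset.univ (b - 1)]
    simp [sub_sub, add_comm]

/-- Writing powers of `ω` as values of an additive character lets phases be added in `ZMod d`, free
of `val` and reductions mod `d`. -/
theorem weyl_apply (hω : ω ^ d = 1) (u : ZMod d × ZMod d) (a b : ZMod d) :
    weyl ω u a b = if a = b - u.1 then AddChar.zmodChar d hω (u.2 * b) else 0 := by
  have h : AddChar.zmodChar d hω (u.2 * b) = (ω ^ b.val) ^ u.2.val := by
    rw [← pow_mul, ← AddChar.zmodChar_apply' hω]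
    simp [mul_comm]
  rw [weyl, weylZ, Matrix.diagonal_pow, Matrix.mul_diagonal, weylX_pow_apply, h]
  simp

theorem zmodChar_sum (hω : ω ^ d = 1) {α : Type*} (s : Finset α) (f : α → ZMod d) :
    AddChar.zmodChar d hω (∑ t ∈ s, f t) = ∏ t ∈ s, AddChar.zmodChar d hω (f t) := by
  classical
  induction s using Finset.induction_on with
  | empty => simp
  | insert a s ha ih => rw [Finset.sum_insert ha, Finset.prod_insert ha, AddChar.map_add_eq_mul, ih]

theorem weylN_apply (hω : ω ^ d = 1) {n : ℕ} (x : Fin n → ZMod d × ZMod d)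
    (a b : Fin n → ZMod d) :
    weylN ω x a b = if a = b - Prod.fst ∘ x then
      AddChar.zmodChar d hω (∑ t, (x t).2 * b t) else 0 := by
  simp only [weylN, Matrix.of_apply, weyl_apply hω]
  rw [Finset.prod_ite_zero, zmodChar_sum]
  simp [funext_iff]

theorem weylN_mul (hω : ω ^ d = 1) {n : ℕ} (x y : Fin n → ZMod d × ZMod d) :
    weylN ω x * weylN ω y
      = AddChar.zmodChar d hω (-∑ t, (x t).2 * (y t).1) • weylN ω (x + y) := by
  ext a c
  -- Column `c` of `N_y` has its only nonzero entry in row `c - Prod.fst ∘ y`.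
  rw [Matrix.mul_apply, Finset.sum_eq_single (c - Prod.fst ∘ y)]
  · have h : c - Prod.fst ∘ y - Prod.fst ∘ x = c - Prod.fst ∘ (x + y) := by
      ext t; simp; ring
    simp only [weylN_apply hω, h, Matrix.smul_apply, smul_eq_mul, if_true]
    split_ifs
    · rw [← AddChar.map_add_eq_mul, ← AddChar.map_add_eq_mul]
      congr 1
      simp only [← Finset.sum_neg_distrib, ← Finset.sum_add_distrib]
      refine Finset.sum_congr rfl fun t _ => ?_
      simp
      ring
    · simp
  · intro b _ hb
    simp [weylN_apply hω y, hb]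
  · simp

/-- The symplectic form enters here, as the difference of the phases of the two products. -/
theorem weylN_mul_comm (hω : ω ^ d = 1) {n : ℕ} (x y : Fin n → ZMod d × ZMod d) :
    weylN ω x * weylN ω y = AddChar.zmodChar d hω (symp x y) • (weylN ω y * weylN ω x) := by
  rw [weylN_mul hω, weylN_mul hω, smul_smul, ← AddChar.map_add_eq_mul, add_comm y x]
  congr 2
  simp only [symp, ← Finset.sum_neg_distrib, ← Finset.sum_add_distrib]
  refine Finset.sum_congr rfl fun t _ => ?_
  ring

theorem star_zmodChar_mul_self (hω : ω ^ d = 1) (a : ZMod d) :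
    star (AddChar.zmodChar d hω a) * AddChar.zmodChar d hω a = 1 := by
  have h : ‖AddChar.zmodChar d hω a‖ = 1 := by
    rw [AddChar.zmodChar_apply, norm_pow, Complex.norm_eq_one_of_pow_eq_one hω (NeZero.ne d),
      one_pow]
  rw [Complex.star_def, Complex.conj_mul', h]
  simp

theorem weylN_conjTranspose_mul_self (hω : ω ^ d = 1) {n : ℕ} (x : Fin n → ZMod d × ZMod d) :
    (weylN ω x)ᴴ * weylN ω x = 1 := by
  ext a c
  rw [Matrix.mul_apply, Finset.sum_eq_single (c - Prod.fst ∘ x)]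
  · simp only [Matrix.conjTranspose_apply, weylN_apply hω, if_true, sub_left_inj,
      Matrix.one_apply]
    by_cases h : c = a
    · subst h
      simpa using star_zmodChar_mul_self hω _
    · simp [h, Ne.symm h]
  · intro b _ hb
    simp [weylN_apply hω, hb]
  · simp

theorem weylN_mul_conjTranspose_self (hω : ω ^ d = 1) {n : ℕ} (x : Fin n → ZMod d × ZMod d) :
    weylN ω x * (weylN ω x)ᴴ = 1 :=
  mul_eq_one_comm.1 (weylN_conjTranspose_mul_self hω x)

theorem weylN_conjTranspose_mul (hω : ω ^ d = 1) {n : ℕ} (x y : Fin n → ZMod d × ZMod d) :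
    ∃ c : ℂ, (weylN ω x)ᴴ * weylN ω y = c • weylN ω (y - x) ∧ star c * c = 1 := by
  refine ⟨AddChar.zmodChar d hω (∑ t, (x t).2 * (y t - x t).1), ?_, star_zmodChar_mul_self hω _⟩
  have h := weylN_mul hω x (y - x)
  rw [add_sub_cancel, AddChar.map_neg_eq_inv] at h
  have h0 : AddChar.zmodChar d hω (∑ t, (x t).2 * (y t - x t).1) ≠ 0 := by
    intro h0
    have h2 := star_zmodChar_mul_self hω (∑ t, (x t).2 * (y t - x t).1)
    rw [h0, mul_zero] at h2
    exact zero_ne_one h2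
  have h1 : weylN ω y = AddChar.zmodChar d hω (∑ t, (x t).2 * (y t - x t).1) •
      (weylN ω x * weylN ω (y - x)) := by
    rw [h, smul_smul]
    simp only [Pi.sub_apply]
    rw [mul_inv_cancel₀ (by simpa using h0), one_smul]
  nth_rw 1 [h1]
  rw [Matrix.mul_smul, ← Matrix.mul_assoc, weylN_conjTranspose_mul_self hω, Matrix.one_mul]

/-! ### Powers of Pauli channels -/

/-- Distributing the product over sites of the single-site sums gives one sum over words `x`; the
two factors `√P(u)` combine to `P(u)`. -/
theorem tensorPower_pauliChannel_apply {P : ZMod d × ZMod d → ℝ} (hP : ∀ u, 0 ≤ P u) {n : ℕ}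
    (ρ : Matrix (Fin n → ZMod d) (Fin n → ZMod d) ℂ) :
    tensorPower n (pauliChannel ω P) ρ
      = ∑ x, (prodDist P x : ℂ) • (weylN ω x * ρ * (weylN ω x)ᴴ) := by
  have hone : ∀ i j a b : ZMod d, pauliChannel ω P (Matrix.single i j 1) a b
      = ∑ u, (P u : ℂ) * (weyl ω u a i * star (weyl ω u b j)) := by
    intro i j a b
    simp only [pauliChannel, krausMap, LinearMap.coe_mk, AddHom.coe_mk, Matrix.sum_apply]
    refine Finset.sum_congr rfl fun u _ => ?_
    have hs : ((Real.sqrt (P u) : ℝ) : ℂ) * ((Real.sqrt (P u) : ℝ) : ℂ) = (P u : ℂ) := by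
      rw [← Complex.ofReal_mul, Real.mul_self_sqrt (hP u)]
    rw [← hs, Matrix.conjTranspose_smul, Matrix.smul_mul, Matrix.smul_mul, Matrix.mul_smul,
      Matrix.smul_apply, Matrix.smul_apply, Matrix.mul_apply, Finset.sum_eq_single j]
    · simp
      ring
    · intro c _ hc
      simp [hc]
    · simp
  ext a b
  simp only [tensorPower, LinearMap.coe_mk, AddHom.coe_mk, Matrix.of_apply, hone,
    Finset.prod_univ_sum, Fintype.piFinset_univ, Matrix.sum_apply, Finset.mul_sum,
    Matrix.smul_apply, Matrix.mul_apply, Finset.sum_mul, smul_eq_mul]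
  simp_rw [Finset.sum_comm (s := (Finset.univ : Finset (Fin n → ZMod d)))
    (t := (Finset.univ : Finset (Fin n → ZMod d × ZMod d)))]
  refine Finset.sum_congr rfl fun x _ => ?_
  rw [Finset.sum_comm]
  refine Finset.sum_congr rfl fun i _ => Finset.sum_congr rfl fun j _ => ?_
  simp only [Finset.prod_mul_distrib, prodDist, weylN, Matrix.of_apply, Matrix.conjTranspose_apply,
    star_prod, Complex.ofReal_prod]
  ring

/-- The matrix of coefficients of a bipartite vector. -/
def coeffMatrix {R ι : Type*} (Ψ : R × ι → ℂ) : Matrix ι R ℂ :=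
  Matrix.of fun i r => Ψ (r, i)

/-- Applying `I ⊗ M` to a bipartite vector is left multiplication of its coefficient matrix by `M`,
so purifications can be treated by matrix algebra. -/
theorem ketBra_vec_mul_coeffMatrix {R ι : Type*} [Fintype ι] (M : Matrix ι ι ℂ) (Ψ : R × ι → ℂ)
    (a b : R × ι) :
    ketBra (Matrix.vec (M * coeffMatrix Ψ)) a b
      = (M * (Matrix.of fun i j => ketBra Ψ (a.1, i) (b.1, j)) * Mᴴ) a.2 b.2 := by
  have hvec : ∀ c, Matrix.vec (M * coeffMatrix Ψ) c = ∑ i, M c.2 i * Ψ (c.1, i) :=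
    fun c => Matrix.mul_apply
  rw [ketBra, Matrix.vecMulVec_apply, Pi.star_apply, hvec, hvec, Matrix.mul_apply, star_sum,
    Finset.sum_mul_sum, Finset.sum_comm]
  refine Finset.sum_congr rfl fun j _ => ?_
  rw [Matrix.mul_apply, Finset.sum_mul]
  refine Finset.sum_congr rfl fun i _ => ?_
  simp only [ketBra, Matrix.vecMulVec_apply, Pi.star_apply, Matrix.of_apply,
    Matrix.conjTranspose_apply, star_mul']
  ring

theorem idTensor_tensorPower_pauliChannel {P : ZMod d × ZMod d → ℝ} (hP : ∀ u, 0 ≤ P u) {n : ℕ}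
    {R : Type*} (Ψ : R × (Fin n → ZMod d) → ℂ) :
    idTensor R (tensorPower n (pauliChannel ω P)) (ketBra Ψ)
      = ∑ x : Fin n → ZMod d × ZMod d,
          (prodDist P x : ℂ) • ketBra (Matrix.vec (weylN ω x * coeffMatrix Ψ)) := by
  ext a b
  simp only [idTensor, tensorPower_pauliChannel_apply hP, LinearMap.coe_mk, AddHom.coe_mk,
    Matrix.of_apply, Matrix.sum_apply, Matrix.smul_apply, ketBra_vec_mul_coeffMatrix]

end Weyl

/-! ### Hyperbolic coordinates -/

section Symplectic

variable {d n k : ℕ}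

theorem symp_add_right (x y z : Fin n → ZMod d × ZMod d) :
    symp x (y + z) = symp x y + symp x z := by
  simp only [symp, ← Finset.sum_add_distrib]
  refine Finset.sum_congr rfl fun t _ => ?_
  simp
  ring

theorem symp_smul_right (c : ZMod d) (x y : Fin n → ZMod d × ZMod d) :
    symp x (c • y) = c * symp x y := by
  simp only [symp, Finset.mul_sum]
  refine Finset.sum_congr rfl fun t _ => ?_
  simp
  ring

theorem symp_swap (x y : Fin n → ZMod d × ZMod d) : symp y x = -symp x y := by
  simp only [symp, ← Finset.sum_neg_distrib]
  refine Finset.sum_congr rfl fun t _ => ?_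
  ring

theorem symp_sub_right (x y z : Fin n → ZMod d × ZMod d) :
    symp x (y - z) = symp x y - symp x z := by
  rw [eq_sub_iff_add_eq, ← symp_add_right, sub_add_cancel]

theorem symp_zero_right (x : Fin n → ZMod d × ZMod d) : symp x 0 = 0 := by
  simp [symp]

theorem symp_sum_right {α : Type*} (s : Finset α) (x : Fin n → ZMod d × ZMod d)
    (f : α → Fin n → ZMod d × ZMod d) : symp x (∑ i ∈ s, f i) = ∑ i ∈ s, symp x (f i) := by
  classical
  induction s using Finset.induction_on with
  | empty => simp [symp_zero_right]
  | insert a s ha ih => rw [Finset.sum_insert ha, Finset.sum_insert ha, symp_add_right, ih]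

variable {g h : Fin n → (Fin n → ZMod d × ZMod d)}

theorem IsHyperbolic.symp_fst_sum (hgh : IsHyperbolic g h) (w z : Fin n → ZMod d) (j : Fin n) :
    symp (g j) (∑ i, (w i • g i + z i • h i)) = z j := by
  simp [symp_sum_right, symp_add_right, symp_smul_right, (hgh j _).1, (hgh j _).2.1]

theorem IsHyperbolic.symp_sum_snd (hgh : IsHyperbolic g h) (w z : Fin n → ZMod d) (j : Fin n) :
    symp (∑ i, (w i • g i + z i • h i)) (h j) = w j := by
  rw [symp_swap]
  simp [symp_sum_right, symp_add_right, symp_smul_right, symp_swap (g _) (h j), (hgh _ j).1,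
    (hgh j _).2.2]

/-- Pairing with `g` and `h` recovers the coordinates, so the coordinate map is injective; both
sides have `d^(2n)` elements, so it is also onto. -/
theorem IsHyperbolic.eq_sum [NeZero d] (hgh : IsHyperbolic g h) (x : Fin n → ZMod d × ZMod d) :
    x = ∑ i, (symp x (h i) • g i + symp (g i) x • h i) := by
  have hinj : Function.Injective fun wz : (Fin n → ZMod d) × (Fin n → ZMod d) =>
      ∑ i, (wz.1 i • g i + wz.2 i • h i) := by
    intro a b hab
    refine Prod.ext (funext fun j => ?_) (funext fun j => ?_)
    · rw [← hgh.symp_sum_snd a.1 a.2 j, ← hgh.symp_sum_snd b.1 b.2 j]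
      exact congrArg (fun x => symp x (h j)) hab
    · rw [← hgh.symp_fst_sum a.1 a.2 j, ← hgh.symp_fst_sum b.1 b.2 j]
      exact congrArg (symp (g j)) hab
  have hbij := (Fintype.bijective_iff_injective_and_card _).2 ⟨hinj, by simp [mul_pow]⟩
  obtain ⟨⟨w, z⟩, rfl⟩ := hbij.2 x
  simp only [hgh.symp_sum_snd, hgh.symp_fst_sum]

/-- The index `(s, u)` of the class of `x` in `cosetDist`. -/
def cosetIndex (hk : k ≤ n) (g h : Fin n → (Fin n → ZMod d × ZMod d))
    (x : Fin n → ZMod d × ZMod d) : (Fin (n - k) → ZMod d) × (Fin k → ZMod d × ZMod d) :=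
  (fun i => symp (g (lowIdx k i)) x,
    fun i => (symp x (h (highIdx hk i)), symp (g (highIdx hk i)) x))

theorem lowIdx_or_highIdx (hk : k ≤ n) (i : Fin n) :
    (∃ j, i = lowIdx k j) ∨ ∃ j, i = highIdx hk j := by
  by_cases hi : (i : ℕ) < n - k
  · exact .inl ⟨⟨i, hi⟩, rfl⟩
  · refine .inr ⟨⟨i - (n - k), by omega⟩, Fin.ext ?_⟩
    simp only [highIdx]
    omega

theorem cosetIndex_surjective [NeZero d] (hk : k ≤ n) (hgh : IsHyperbolic g h) :
    Function.Surjective (cosetIndex hk g h) := by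
  rintro ⟨s, u⟩
  -- The coefficients of the first `n - k` vectors `g_i` do not affect the index, so they are set to
  -- `0`.
  set w : Fin n → ZMod d := fun j =>
    if hj : (j : ℕ) < n - k then 0 else (u ⟨j - (n - k), by omega⟩).1 with hw
  set z : Fin n → ZMod d := fun j =>
    if hj : (j : ℕ) < n - k then s ⟨j, hj⟩ else (u ⟨j - (n - k), by omega⟩).2 with hz
  refine ⟨∑ i, (w i • g i + z i • h i), ?_⟩
  simp only [cosetIndex, hgh.symp_fst_sum, hgh.symp_sum_snd]
  refine Prod.ext (funext fun i => ?_) (funext fun i => Prod.ext ?_ ?_)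
  · simp [hz, lowIdx]
  · simp [hw, highIdx]
  · simp [hz, highIdx]

/-- The classes become fibres of a map, so sums over `x` can be grouped by `Finset.sum_fiberwise`.
-/
theorem cosetDist_apply [NeZero d] (hk : k ≤ n) (hgh : IsHyperbolic g h)
    (P : ZMod d × ZMod d → ℝ) (su : (Fin (n - k) → ZMod d) × (Fin k → ZMod d × ZMod d)) :
    cosetDist hk g h P su
      = ∑ x ∈ Finset.univ.filter (fun x => cosetIndex hk g h x = su), prodDist P x := by
  unfold cosetDist
  congr 1
  ext x
  simp only [Finset.mem_filter, Finset.mem_univ, true_and]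
  constructor
  · rintro ⟨w, z, rfl, h1, h2⟩
    simp only [cosetIndex, hgh.symp_fst_sum, hgh.symp_sum_snd]
    exact Prod.ext (funext h1) (funext fun i => Prod.ext (h2 i).1 (h2 i).2)
  · rintro rfl
    exact ⟨_, _, hgh.eq_sum x, fun i => rfl, fun i => ⟨rfl, rfl⟩⟩

theorem cosetDist_nonneg [NeZero d] (hk : k ≤ n) {P : ZMod d × ZMod d → ℝ} (hP : ∀ u, 0 ≤ P u)
    (su : (Fin (n - k) → ZMod d) × (Fin k → ZMod d × ZMod d)) :
    0 ≤ cosetDist hk g h P su :=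
  Finset.sum_nonneg fun _ _ => Finset.prod_nonneg fun _ _ => hP _

theorem sum_marginal_cosetDist [NeZero d] (hk : k ≤ n) (hgh : IsHyperbolic g h)
    {P : ZMod d × ZMod d → ℝ} (hP : ∑ u, P u = 1) :
    ∑ s, marginal (cosetDist hk g h P) s = 1 := by
  simp only [marginal]
  rw [← Fintype.sum_prod_type]
  simp only [cosetDist_apply hk hgh]
  rw [Finset.sum_fiberwise]
  simp only [prodDist]
  rw [← Fintype.piFinset_univ, ← Finset.prod_univ_sum]
  simp [hP]

variable {L : Submodule (ZMod d) (Fin n → ZMod d × ZMod d)}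

theorem mem_perp_span_iff {α : Type*} {f : α → Fin n → ZMod d × ZMod d}
    {y : Fin n → ZMod d × ZMod d} :
    y ∈ perp (Submodule.span (ZMod d) (Set.range f)) ↔ ∀ i, symp (f i) y = 0 := by
  refine ⟨fun hy i => hy _ (Submodule.subset_span ⟨i, rfl⟩), fun hy x hx => ?_⟩
  rw [symp_swap, neg_eq_zero]
  induction hx using Submodule.span_induction with
  | mem x hx =>
    obtain ⟨i, rfl⟩ := hx
    rw [symp_swap, hy, neg_zero]
  | zero => exact symp_zero_right y
  | add a b _ _ ha hb => rw [symp_add_right, ha, hb, add_zero]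
  | smul c a _ ha => rw [symp_smul_right, ha, mul_zero]

/-- The first index component is the syndrome: it lists the pairings with generators of `L`. -/
theorem sub_mem_perp (hk : k ≤ n)
    (hspan : L = Submodule.span (ZMod d) (Set.range fun i : Fin (n - k) => g (lowIdx k i)))
    {x y : Fin n → ZMod d × ZMod d}
    (hxy : (cosetIndex hk g h x).1 = (cosetIndex hk g h y).1) : x - y ∈ perp L := by
  rw [hspan, mem_perp_span_iff]
  intro i
  rw [symp_sub_right]
  exact sub_eq_zero.2 (congrFun hxy i)

theorem exists_mem_symp_sub_ne_zero (hk : k ≤ n)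
    (hspan : L = Submodule.span (ZMod d) (Set.range fun i : Fin (n - k) => g (lowIdx k i)))
    {x y : Fin n → ZMod d × ZMod d}
    (hxy : (cosetIndex hk g h x).1 ≠ (cosetIndex hk g h y).1) :
    ∃ m ∈ L, symp m (x - y) ≠ 0 := by
  obtain ⟨i, hi⟩ := Function.ne_iff.1 hxy
  refine ⟨g (lowIdx k i), hspan ▸ Submodule.subset_span ⟨i, rfl⟩, ?_⟩
  rw [symp_sub_right]
  exact sub_ne_zero.2 hi

/-- The only coordinates the index forgets are the coefficients of the first `n - k` vectors `g_i`,
which span `L`. -/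
theorem sub_mem_of_cosetIndex_eq [NeZero d] (hk : k ≤ n) (hgh : IsHyperbolic g h)
    (hspan : L = Submodule.span (ZMod d) (Set.range fun i : Fin (n - k) => g (lowIdx k i)))
    {x y : Fin n → ZMod d × ZMod d} (hxy : cosetIndex hk g h x = cosetIndex hk g h y) :
    x - y ∈ L := by
  have h1 := fun i => congrFun (congrArg Prod.fst hxy) i
  have h2 := fun i => congrFun (congrArg Prod.snd hxy) i
  simp only [cosetIndex, Prod.mk.injEq] at h1 h2
  rw [hgh.eq_sum (x - y)]
  refine Submodule.sum_mem _ fun i _ => ?_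
  rcases lowIdx_or_highIdx hk i with ⟨j, rfl⟩ | ⟨j, rfl⟩
  · rw [symp_sub_right, h1 j, sub_self, zero_smul, add_zero, hspan]
    exact Submodule.smul_mem _ _ (Submodule.subset_span ⟨j, rfl⟩)
  · have h3 : symp (x - y) (h (highIdx hk j)) = 0 := by
      rw [symp_swap, symp_sub_right, symp_swap x, symp_swap y, (h2 j).1, sub_self, neg_zero]
    rw [symp_sub_right, (h2 j).2, sub_self, h3, zero_smul, zero_smul, add_zero]
    exact Submodule.zero_mem _

/-- Each coordinate of the index is, up to sign, a pairing with some `g_i` or with one of the last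
`k` vectors `h_i`, and all of these lie in `L^⊥`. -/
theorem exists_mem_perp_symp_sub_ne_zero (hk : k ≤ n) (hgh : IsHyperbolic g h)
    (hspan : L = Submodule.span (ZMod d) (Set.range fun i : Fin (n - k) => g (lowIdx k i)))
    {x y : Fin n → ZMod d × ZMod d} (hxy : cosetIndex hk g h x ≠ cosetIndex hk g h y) :
    ∃ z ∈ perp L, symp z (x - y) ≠ 0 := by
  by_contra! hcon
  have hg : ∀ i, g i ∈ perp L := fun i => by
    rw [hspan, mem_perp_span_iff]
    exact fun j => (hgh _ i).2.1
  have hh : ∀ i, h (highIdx hk i) ∈ perp L := fun i => by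
    rw [hspan, mem_perp_span_iff]
    intro j
    rw [(hgh _ _).1, if_neg]
    intro hij
    have := congrArg Fin.val hij
    simp only [lowIdx, highIdx] at this
    omega
  refine hxy (Prod.ext (funext fun i => ?_) (funext fun i => Prod.ext ?_ ?_))
  · have := hcon _ (hg (lowIdx k i))
    rwa [symp_sub_right, sub_eq_zero] at this
  · have := hcon _ (hh i)
    rw [symp_sub_right, sub_eq_zero] at this
    simp only [cosetIndex]
    rw [symp_swap _ x, symp_swap _ y, this]
  · have := hcon _ (hg (highIdx hk i))
    rwa [symp_sub_right, sub_eq_zero] at this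

end Symplectic

/-! ### The code and its translates -/

theorem exists_isometry_projMatrix {ι : Type*} [Fintype ι] [DecidableEq ι] {D : ℕ}
    (C : Submodule ℂ (EuclideanSpace ℂ ι)) (hD : Module.finrank ℂ C = D) :
    ∃ B : Matrix ι (Fin D) ℂ, Bᴴ * B = 1 ∧ projMatrix C = B * Bᴴ ∧
      (∀ j, WithLp.toLp 2 (fun i => B i j) ∈ C) ∧
      ∀ {m : Type} (M : Matrix ι m ℂ), (∀ j, WithLp.toLp 2 (fun i => M i j) ∈ C) →
        projMatrix C * M = M := by
  subst hD
  set b := stdOrthonormalBasis ℂ C with hb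
  refine ⟨Matrix.of fun i j => (b j : EuclideanSpace ℂ ι) i, ?_, ?_, ?_, ?_⟩
  · ext i j
    have h := orthonormal_iff_ite.1 b.orthonormal i j
    rw [Submodule.coe_inner, EuclideanSpace.inner_eq_star_dotProduct] at h
    rw [Matrix.one_apply, ← h, Matrix.mul_apply, dotProduct]
    exact Finset.sum_congr rfl fun t _ => by simp [mul_comm]
  · rw [projMatrix, b.starProjection_eq_sum_rankOne]
    ext i j
    simp [Matrix.mul_apply, Matrix.sum_apply, InnerProductSpace.symm_toEuclideanLin_rankOne,
      Matrix.vecMulVec_apply]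
  · intro j
    exact (b j).2
  · intro m M hM
    ext i j
    have h : Matrix.toEuclideanLin (projMatrix C) (WithLp.toLp 2 fun i => M i j)
        = WithLp.toLp 2 fun i => M i j := by
      rw [projMatrix, LinearEquiv.apply_symm_apply]
      exact Submodule.starProjection_eq_self_iff.2 (hM j)
    exact congrFun (congrArg WithLp.ofLp h) i

section Code

variable {d n k : ℕ} [NeZero d] {ω : ℂ} {L : Submodule (ZMod d) (Fin n → ZMod d × ZMod d)}
  {C : Submodule ℂ (EuclideanSpace ℂ (Fin n → ZMod d))}

/-- For `z ∈ L^⊥`, both `N_z` and its adjoint commute with `N_L` and so preserve every joint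
eigenspace; hence `C` reduces `N_z`. -/
theorem IsSymplecticCode.exists_isometry (hω : ω ^ d = 1) (hC : IsSymplecticCode ω k L C) :
    ∃ (B : Matrix (Fin n → ZMod d) (Fin (d ^ k)) ℂ) (τ : (Fin n → ZMod d × ZMod d) → ℂ),
      Bᴴ * B = 1 ∧ projMatrix C = B * Bᴴ ∧ (∀ m ∈ L, star (τ m) * τ m = 1) ∧
      (∀ m ∈ L, weylN ω m * B = τ m • B) ∧
      ∀ z ∈ perp L, weylN ω z * (B * Bᴴ) = (B * Bᴴ) * weylN ω z := by
  obtain ⟨hrank, τ, hτ⟩ := hC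
  obtain ⟨B, hBB, hproj, hBC, hC⟩ := exists_isometry_projMatrix C hrank
  have hmem : ∀ {m : Type} (M : Matrix (Fin n → ZMod d) m ℂ),
      (∀ j, WithLp.toLp 2 (fun i => M i j) ∈ C) ↔
        ∀ x ∈ L, weylN ω x * M = τ (weylN ω x) • M := by
    intro m M
    constructor
    · intro h x hx
      ext i j
      exact congrFun (congrArg WithLp.ofLp ((hτ _).1 (h j) _ ⟨x, hx, rfl⟩)) i
    · intro h j
      refine (hτ _).2 ?_
      rintro _ ⟨x, hx, rfl⟩
      refine (WithLp.ofLp_injective 2) (funext fun i => ?_)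
      exact congrFun (congrFun (h x hx) i) j
  have hNB := (hmem B).1 hBC
  -- Invariance of the code under `M`, in the form `ΠMΠ = MΠ`.
  have hcomm : ∀ M : Matrix (Fin n → ZMod d) (Fin n → ZMod d) ℂ,
      (∀ x ∈ L, weylN ω x * M = M * weylN ω x) →
      (B * Bᴴ) * (M * (B * Bᴴ)) = M * (B * Bᴴ) := by
    intro M hM
    have h : projMatrix C * (M * B) = M * B := hC _ <| (hmem _).2 fun x hx => by
      rw [← Matrix.mul_assoc, hM x hx, Matrix.mul_assoc, hNB x hx, Matrix.mul_smul]
    rw [← Matrix.mul_assoc M, ← Matrix.mul_assoc, ← hproj, h]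
  refine ⟨B, fun m => τ (weylN ω m), hBB, hproj, fun m hm => ?_, hNB, fun z hz => ?_⟩
  -- `N_m` is unitary and `B` an isometry, so the eigenvalue has modulus one; it is read off at a
  -- diagonal entry, which exists because `d^k > 0`.
  · have h : (weylN ω m * B)ᴴ * (weylN ω m * B) = 1 := by
      rw [Matrix.conjTranspose_mul, Matrix.mul_assoc, ← Matrix.mul_assoc _ _ B,
        weylN_conjTranspose_mul_self hω, Matrix.one_mul, hBB]
    rw [hNB m hm, Matrix.conjTranspose_smul, Matrix.smul_mul, Matrix.mul_smul, hBB,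
      smul_smul] at h
    have hpos : 0 < d ^ k := pow_pos (Nat.pos_of_ne_zero (NeZero.ne d)) k
    simpa using congrFun (congrFun h ⟨0, hpos⟩) ⟨0, hpos⟩
  · have h1 : ∀ x ∈ L, weylN ω x * weylN ω z = weylN ω z * weylN ω x := fun x hx => by
      rw [weylN_mul_comm hω, hz x hx, AddChar.map_zero_eq_one, one_smul]
    have h2 : ∀ x ∈ L, weylN ω x * (weylN ω z)ᴴ = (weylN ω z)ᴴ * weylN ω x := fun x hx => by
      calc weylN ω x * (weylN ω z)ᴴ
          = (weylN ω z)ᴴ * (weylN ω z * weylN ω x) * (weylN ω z)ᴴ := by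
            rw [← Matrix.mul_assoc, weylN_conjTranspose_mul_self hω, Matrix.one_mul]
        _ = _ := by
            rw [← h1 x hx, ← Matrix.mul_assoc, Matrix.mul_assoc _ _ (weylN ω z)ᴴ,
              weylN_mul_conjTranspose_self hω, Matrix.mul_one]
    -- The adjoint of the invariance under `N_z†` is `ΠN_zΠ = ΠN_z`.
    have h3 := congrArg Matrix.conjTranspose (hcomm _ h2)
    simp only [Matrix.conjTranspose_mul, Matrix.conjTranspose_conjTranspose] at h3
    rw [← hcomm _ h1, ← h3]
    simp only [Matrix.mul_assoc]

theorem zmodChar_ne_one (hω : IsPrimitiveRoot ω d) {a : ZMod d} (ha : a ≠ 0) :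
    AddChar.zmodChar d hω.pow_eq_one a ≠ 1 := by
  rw [AddChar.zmodChar_apply]
  exact hω.pow_ne_one_of_pos_of_lt ((ZMod.val_ne_zero a).2 ha) (ZMod.val_lt a)

variable {B : Matrix (Fin n → ZMod d) (Fin (d ^ k)) ℂ}

/-- Conjugation by the unitary `N_z` preserves the trace but multiplies `N_y Q` by a nontrivial root
of unity. -/
theorem trace_weylN_mul_eq_zero (hω : IsPrimitiveRoot ω d)
    {Q : Matrix (Fin n → ZMod d) (Fin n → ZMod d) ℂ} {y z : Fin n → ZMod d × ZMod d}
    (hz : weylN ω z * Q = Q * weylN ω z) (hzy : symp z y ≠ 0) :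
    (weylN ω y * Q).trace = 0 := by
  have h1 : weylN ω z * (weylN ω y * Q) * (weylN ω z)ᴴ
      = AddChar.zmodChar d hω.pow_eq_one (symp z y) • (weylN ω y * Q) := by
    rw [← Matrix.mul_assoc, weylN_mul_comm hω.pow_eq_one z y, Matrix.smul_mul, Matrix.smul_mul,
      Matrix.mul_assoc _ _ Q, hz, Matrix.mul_assoc, Matrix.mul_assoc,
      weylN_mul_conjTranspose_self hω.pow_eq_one, Matrix.mul_one]
  have h2 := congrArg Matrix.trace h1
  rw [Matrix.trace_mul_comm, ← Matrix.mul_assoc, weylN_conjTranspose_mul_self hω.pow_eq_one,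
    Matrix.one_mul, Matrix.trace_smul, smul_eq_mul] at h2
  by_contra h0
  exact zmodChar_ne_one hω hzy (mul_right_cancel₀ h0 (by rw [← h2, one_mul]))

/-- The range of `B` and its translate by `N_y` lie in eigenspaces of the unitary `N_m` for
different eigenvalues. Concretely, `Bᴴ N_m N_y B` is evaluated by letting `N_m` act to the left and
to the right. -/
theorem conjTranspose_mul_weylN_mul_eq_zero (hω : IsPrimitiveRoot ω d)
    {m y : Fin n → ZMod d × ZMod d} {c : ℂ} (hc : star c * c = 1)
    (hm : weylN ω m * B = c • B) (hmy : symp m y ≠ 0) :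
    Bᴴ * (weylN ω y * B) = 0 := by
  have hω1 := hω.pow_eq_one
  have hc0 : c ≠ 0 := by
    rintro rfl
    simp at hc
  have h1 : (weylN ω m)ᴴ * B = star c • B := by
    have h : (weylN ω m)ᴴ * (weylN ω m * B) = B := by
      rw [← Matrix.mul_assoc, weylN_conjTranspose_mul_self hω1, Matrix.one_mul]
    nth_rw 2 [← h]
    rw [hm, Matrix.mul_smul, smul_smul, hc, one_smul]
  have h2 : Bᴴ * weylN ω m = c • Bᴴ := by
    simpa using congrArg Matrix.conjTranspose h1
  have h3 : c • (Bᴴ * (weylN ω y * B))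
      = (AddChar.zmodChar d hω1 (symp m y) * c) • (Bᴴ * (weylN ω y * B)) := by
    calc c • (Bᴴ * (weylN ω y * B)) = Bᴴ * (weylN ω m * weylN ω y * B) := by
          rw [← Matrix.smul_mul, ← h2]
          simp only [Matrix.mul_assoc]
      _ = _ := by
          rw [weylN_mul_comm hω1, Matrix.smul_mul, Matrix.mul_smul, Matrix.mul_assoc, hm,
            Matrix.mul_smul, Matrix.mul_smul, smul_smul]
  by_contra h0
  rw [← sub_eq_zero, ← sub_smul, smul_eq_zero, or_iff_left h0, sub_eq_zero] at h3
  exact zmodChar_ne_one hω hmy (mul_right_cancel₀ hc0 (by rw [← h3, one_mul]))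

theorem weylN_eq_smul_mul (hω : ω ^ d = 1) (x y : Fin n → ZMod d × ZMod d) :
    ∃ c : ℂ, weylN ω x = c • (weylN ω y * weylN ω (x - y)) ∧ star c * c = 1 := by
  obtain ⟨c, h, hc⟩ := weylN_conjTranspose_mul hω y x
  refine ⟨c, ?_, hc⟩
  rw [← Matrix.mul_smul, ← h, ← Matrix.mul_assoc, weylN_mul_conjTranspose_self hω, Matrix.one_mul]

theorem weylN_conj_eq (hω : ω ^ d = 1) {Q : Matrix (Fin n → ZMod d) (Fin n → ZMod d) ℂ}
    {x y : Fin n → ZMod d × ZMod d} (h : weylN ω (x - y) * Q = Q * weylN ω (x - y)) :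
    weylN ω x * Q * (weylN ω x)ᴴ = weylN ω y * Q * (weylN ω y)ᴴ := by
  obtain ⟨c, hx, hc⟩ := weylN_eq_smul_mul hω x y
  rw [hx, Matrix.conjTranspose_smul, Matrix.smul_mul, Matrix.smul_mul, Matrix.mul_smul, smul_smul,
    mul_comm c, hc, one_smul, Matrix.mul_assoc (weylN ω y), h, Matrix.conjTranspose_mul]
  simp only [Matrix.mul_assoc]
  rw [← Matrix.mul_assoc (weylN ω (x - y)), weylN_mul_conjTranspose_self hω, Matrix.one_mul]

theorem ketBra_smul_of_unit {ι : Type*} {c : ℂ} (hc : star c * c = 1) (v : ι → ℂ) :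
    ketBra (fun i => c * v i) = ketBra v := by
  ext i j
  simp only [ketBra, Matrix.vecMulVec_apply, Pi.star_apply, star_mul']
  linear_combination (v i * star (v j)) * hc

end Code

/-! ### Spectral decompositions of the channel outputs -/

theorem sum_smul_eq_sum_fiber {X S M : Type*} [Fintype X] [Fintype S] [DecidableEq S]
    [AddCommGroup M] [Module ℂ M] (p : X → ℝ) {F : X → M} {G : S → M} {idx : X → S}
    (h : ∀ x, F x = G (idx x)) :
    ∑ x, (p x : ℂ) • F x
      = ∑ s, ((∑ x ∈ Finset.univ.filter (fun x => idx x = s), p x : ℝ) : ℂ) • G s := by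
  rw [← Finset.sum_fiberwise Finset.univ idx]
  refine Finset.sum_congr rfl fun s _ => ?_
  rw [Complex.ofReal_sum, Finset.sum_smul]
  refine Finset.sum_congr rfl fun x hx => ?_
  rw [h, (Finset.mem_filter.1 hx).2]

section Output

variable {d n k : ℕ} [NeZero d] {ω : ℂ} {L : Submodule (ZMod d) (Fin n → ZMod d × ZMod d)}
  {C : Submodule ℂ (EuclideanSpace ℂ (Fin n → ZMod d))}
  {g h : Fin n → (Fin n → ZMod d × ZMod d)} {P : ZMod d × ZMod d → ℝ}

theorem star_dotProduct_col {ι m : Type*} [Fintype ι] (A B : Matrix ι m ℂ) (i j : m) :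
    star (fun t => A t i) ⬝ᵥ (fun t => B t j) = (Aᴴ * B) i j := by
  simp [dotProduct, Matrix.mul_apply]

theorem star_dotProduct_vec {ι m : Type*} [Fintype ι] [Fintype m] (A B : Matrix ι m ℂ) :
    star A.vec ⬝ᵥ B.vec = (Aᴴ * B).trace := by
  simp [dotProduct, Matrix.trace, Matrix.mul_apply, Matrix.vec, Fintype.sum_prod_type]

theorem maxMixed_eq {B : Matrix (Fin n → ZMod d) (Fin (d ^ k)) ℂ}
    (hC : IsSymplecticCode ω k L C) (hB : projMatrix C = B * Bᴴ) :
    maxMixed C = ((d : ℂ) ^ k)⁻¹ • (B * Bᴴ) := by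
  rw [maxMixed, hC.1, hB]
  push_cast
  rfl

open scoped ComplexOrder in
theorem IsSymplecticCode.maxMixed_posSemidef (hω : ω ^ d = 1) (hC : IsSymplecticCode ω k L C) :
    (maxMixed C).PosSemidef := by
  obtain ⟨B, τ, -, hproj, -⟩ := hC.exists_isometry hω
  rw [maxMixed_eq hC hproj]
  refine (Matrix.posSemidef_self_mul_conjTranspose B).smul ?_
  rw [← Nat.cast_pow]
  exact inv_nonneg.2 (Nat.cast_nonneg _)

theorem vonNeumannEntropy_output (hd : 1 < d) (hω : IsPrimitiveRoot ω d) (hP : IsProbDist P)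
    (hk : k ≤ n) (hgh : IsHyperbolic g h)
    (hspan : L = Submodule.span (ZMod d) (Set.range fun i : Fin (n - k) => g (lowIdx k i)))
    (hC : IsSymplecticCode ω k L C) :
    vonNeumannEntropy d (tensorPower n (pauliChannel ω P) (maxMixed C))
      = shannonEntropy d (marginal (cosetDist hk g h P)) + k := by
  have hω1 := hω.pow_eq_one
  obtain ⟨B, τ, hBB, hproj, hτ, hLB, hperp⟩ := hC.exists_isometry hω1
  set r := Function.surjInv (cosetIndex_surjective hk hgh)
  have hr : ∀ su, cosetIndex hk g h (r su) = su := Function.surjInv_eq _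
  rw [← mul_sum_logb_div hd (sum_marginal_cosetDist hk hgh hP.2)]
  -- The eigenvectors are the columns of `N_{r(s,0)} B`. The choice `u = 0` is arbitrary, since only
  -- the syndrome matters for the translated code.
  refine vonNeumannEntropy_of_orthonormal d
    (fun a : (Fin (n - k) → ZMod d) × Fin (d ^ k) =>
      marginal (cosetDist hk g h P) a.1 / (d : ℝ) ^ k)
    (fun a i => (weylN ω (r (a.1, 0)) * B) i a.2) ?_ ?_
  · rintro ⟨s, i⟩ ⟨t, j⟩
    rw [star_dotProduct_col, Matrix.conjTranspose_mul, Matrix.mul_assoc, ← Matrix.mul_assoc _ _ B]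
    by_cases hst : s = t
    · subst hst
      rw [weylN_conjTranspose_mul_self hω1, Matrix.one_mul, hBB, Matrix.one_apply]
      simp
    · obtain ⟨c, hc, -⟩ := weylN_conjTranspose_mul hω1 (r (s, 0)) (r (t, 0))
      obtain ⟨m, hm, hne⟩ := exists_mem_symp_sub_ne_zero (x := r (t, 0)) (y := r (s, 0)) hk hspan
        (by rw [hr, hr]; exact Ne.symm hst)
      rw [hc, Matrix.smul_mul, Matrix.mul_smul,
        conjTranspose_mul_weylN_mul_eq_zero hω (hτ m hm) (hLB m hm) hne]
      simp [hst]
  · rw [tensorPower_pauliChannel_apply hP.1, sum_smul_eq_sum_fiber (prodDist P)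
      (idx := cosetIndex hk g h)
      (G := fun su => weylN ω (r (su.1, 0)) * maxMixed C * (weylN ω (r (su.1, 0)))ᴴ)]
    · simp only [← cosetDist_apply hk hgh]
      rw [Fintype.sum_prod_type, Fintype.sum_prod_type]
      refine Finset.sum_congr rfl fun s _ => ?_
      dsimp only
      rw [← Finset.sum_smul, ← Finset.smul_sum, ← Complex.ofReal_sum, maxMixed_eq hC hproj,
        Complex.ofReal_div, div_eq_mul_inv, mul_smul, marginal]
      congr 1
      rw [Matrix.mul_smul, Matrix.smul_mul, Complex.ofReal_pow, Complex.ofReal_natCast]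
      congr 1
      rw [← Matrix.mul_assoc, Matrix.mul_assoc, ← Matrix.conjTranspose_mul]
      ext a b
      rw [Matrix.mul_apply, Matrix.sum_apply]
      simp only [ketBra, Matrix.vecMulVec_apply, Pi.star_apply, Matrix.conjTranspose_apply]
    · intro x
      refine weylN_conj_eq hω1 ?_
      rw [maxMixed_eq hC hproj, Matrix.mul_smul, Matrix.smul_mul, hperp]
      exact sub_mem_perp hk hspan (by rw [hr])

open scoped ComplexOrder in
theorem vonNeumannEntropy_purified_output (hω : IsPrimitiveRoot ω d)
    (hP : IsProbDist P) (hk : k ≤ n) (hgh : IsHyperbolic g h)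
    (hspan : L = Submodule.span (ZMod d) (Set.range fun i : Fin (n - k) => g (lowIdx k i)))
    (hC : IsSymplecticCode ω k L C) {R : Type*} [Fintype R] {Ψ : R × (Fin n → ZMod d) → ℂ}
    (hΨ : IsPurification Ψ (maxMixed C)) :
    vonNeumannEntropy d (idTensor R (tensorPower n (pauliChannel ω P)) (ketBra Ψ))
      = shannonEntropy d (cosetDist hk g h P) := by
  have hω1 := hω.pow_eq_one
  obtain ⟨B, τ, hBB, hproj, hτ, hLB, hperp⟩ := hC.exists_isometry hω1
  have hA : coeffMatrix Ψ * (coeffMatrix Ψ)ᴴ = maxMixed C := by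
    ext i j
    rw [← hΨ i j, Matrix.mul_apply]
    exact Finset.sum_congr rfl fun _ _ => rfl
  set A := coeffMatrix Ψ with hAdef
  have hρ := maxMixed_eq hC hproj
  -- The eigenvalue equation passes from `ρ = A Aᴴ` to `A`, because `M A Aᴴ = 0` forces `M A = 0`;
  -- this works for every reference system.
  have hLA : ∀ m ∈ L, weylN ω m * A = τ m • A := by
    intro m hm
    have h0 : (weylN ω m - τ m • 1) * (A * Aᴴ) = 0 := by
      rw [hA, hρ, Matrix.mul_smul, ← Matrix.mul_assoc, Matrix.sub_mul, hLB m hm, Matrix.smul_mul,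
        Matrix.one_mul, sub_self, Matrix.zero_mul, smul_zero]
    rw [Matrix.mul_self_mul_conjTranspose_eq_zero, Matrix.sub_mul, Matrix.smul_mul,
      Matrix.one_mul, sub_eq_zero] at h0
    exact h0
  have hdk : ((d : ℂ) ^ k) ≠ 0 := pow_ne_zero _ (Nat.cast_ne_zero.2 (NeZero.ne d))
  set r := Function.surjInv (cosetIndex_surjective hk hgh)
  have hr : ∀ su, cosetIndex hk g h (r su) = su := Function.surjInv_eq _
  refine vonNeumannEntropy_of_orthonormal d _ (fun su => (Matrix.vec (weylN ω (r su) * A))) ?_ ?_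
  · intro a b
    -- Inner products of the translated vectors depend on the purification only through `ρ`.
    have htr : star (Matrix.vec (weylN ω (r a) * A)) ⬝ᵥ (Matrix.vec (weylN ω (r b) * A))
        = ((weylN ω (r a))ᴴ * weylN ω (r b) * maxMixed C).trace := by
      rw [star_dotProduct_vec, Matrix.conjTranspose_mul, Matrix.mul_assoc, Matrix.trace_mul_comm,
        ← Matrix.mul_assoc, Matrix.mul_assoc, hA]
    rw [htr]
    by_cases hab : a = b
    · subst hab
      rw [weylN_conjTranspose_mul_self hω1, Matrix.one_mul, hρ, Matrix.trace_smul,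
        Matrix.trace_mul_comm, hBB, Matrix.trace_one, Fintype.card_fin]
      simp [hdk]
    · obtain ⟨c, hc, -⟩ := weylN_conjTranspose_mul hω1 (r a) (r b)
      obtain ⟨z, hz, hne⟩ := exists_mem_perp_symp_sub_ne_zero (x := r b) (y := r a) hk hgh hspan
        (by rw [hr, hr]; exact Ne.symm hab)
      rw [hc, hρ, Matrix.smul_mul, Matrix.mul_smul, Matrix.trace_smul, Matrix.trace_smul,
        trace_weylN_mul_eq_zero hω (hperp z hz) hne]
      simp [hab]
  · rw [idTensor_tensorPower_pauliChannel hP.1, ← hAdef, sum_smul_eq_sum_fiber (prodDist P)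
      (idx := cosetIndex hk g h) (G := fun su => ketBra (Matrix.vec (weylN ω (r su) * A)))]
    · simp only [← cosetDist_apply hk hgh]
    · intro x
      have hm := sub_mem_of_cosetIndex_eq hk hgh hspan (hr (cosetIndex hk g h x)).symm
      obtain ⟨c, hx, hc⟩ := weylN_eq_smul_mul hω1 x (r (cosetIndex hk g h x))
      -- Within a class the vectors differ by the Weyl product phase times the eigenvalue of an
      -- element of `N_L`, both of modulus one.
      have hunit : star (c * τ (x - r (cosetIndex hk g h x)))
          * (c * τ (x - r (cosetIndex hk g h x))) = 1 := by
        rw [star_mul', mul_mul_mul_comm, hc, hτ _ hm, one_mul]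
      rw [← ketBra_smul_of_unit hunit (Matrix.vec
        (weylN ω (r (cosetIndex hk g h x)) * A))]
      congr 1
      funext a
      rw [hx, Matrix.smul_mul, Matrix.mul_assoc, hLA _ hm, Matrix.mul_smul, smul_smul]
      rfl

end Output

end SympCode

theorem mainTheorem4 {d : ℕ} [Fact d.Prime] (ω : ℂ) (hω : IsPrimitiveRoot ω d)
    (P : ZMod d × ZMod d → ℝ) (hP : IsProbDist P)
    {n k : ℕ} (hk : k ≤ n)
    (L : Submodule (ZMod d) (Fin n → ZMod d × ZMod d))
    (hL : IsSelfOrthogonal L) (hdim : Module.finrank (ZMod d) L = n - k)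
    (g h : Fin n → (Fin n → ZMod d × ZMod d)) (hgh : IsHyperbolic g h)
    (hspan : L = Submodule.span (ZMod d) (Set.range fun i : Fin (n - k) => g (lowIdx k i)))
    (C : Submodule ℂ (EuclideanSpace ℂ (Fin n → ZMod d)))
    (hC : IsSymplecticCode ω k L C) :
    (k : ℝ) - condEntropy d (conditional (cosetDist hk g h P)) (marginal (cosetDist hk g h P))
        = coherentInformation d (maxMixed C) (tensorPower n (pauliChannel ω P)) ∧
      vonNeumannEntropy d (tensorPower n (pauliChannel ω P) (maxMixed C))
        = shannonEntropy d (marginal (cosetDist hk g h P)) + k ∧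
      ∀ (R : Type) [Fintype R] (Ψ : R × (Fin n → ZMod d) → ℂ), IsPurification Ψ (maxMixed C) →
        vonNeumannEntropy d (idTensor R (tensorPower n (pauliChannel ω P)) (ketBra Ψ))
          = shannonEntropy d (marginal (cosetDist hk g h P))
            + condEntropy d (conditional (cosetDist hk g h P))
                (marginal (cosetDist hk g h P)) := by
  have hω1 := hω.pow_eq_one
  have hout := vonNeumannEntropy_output (Fact.out : d.Prime).one_lt hω hP hk hgh hspan hC
  have hpur : ∀ (R : Type) [Fintype R] (Ψ : R × (Fin n → ZMod d) → ℂ),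
      IsPurification Ψ (maxMixed C) →
        vonNeumannEntropy d (idTensor R (tensorPower n (pauliChannel ω P)) (ketBra Ψ))
          = shannonEntropy d (marginal (cosetDist hk g h P))
            + condEntropy d (conditional (cosetDist hk g h P))
                (marginal (cosetDist hk g h P)) := by
    intro R _ Ψ hΨ
    rw [vonNeumannEntropy_purified_output hω hP hk hgh hspan hC hΨ,
      shannonEntropy_eq_marginal_add_condEntropy d (cosetDist_nonneg hk hP.1)]
  refine ⟨?_, hout, hpur⟩
  -- The canonical purification is one admissible `Ψ`, so the two entropy formulas can be
  -- subtracted.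
  rw [coherentInformation, hout,
    hpur _ _ (isPurification_canonicalPurification (hC.maxMixed_posSemidef hω1))]
  ring
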